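/- Theorem 1. Let $M$ be a smooth manifold and let $F$ be a Finsler metric on an open conic subset $\mathcal D$ of the slit tangent bundle $TM\setminus 0$ (the ordinary case being $\mathcal D=TM\setminus 0$): $F\ge 0$ is $C^\infty$ on $\mathcal D$, $\mathcal L_{\mathcal C}F=F$ for the Liouville vector field $\mathcal C$, and the Hilbert $2$-form $dd_JE$, $E=\tfrac12F^2$, has maximal rank. Let $g(\rho W,\rho Z)=dd_JE(JW,Z)$ be its metric tensor on the pullback bundle $\pi^{-1}(TM)$. Let $\overline\varphi$ be a concurrent $\pi$-vector field, that is, a smooth non-vanishing section of $\pi^{-1}(TM)$ over $\mathcal D$ with $D^\circ_{\beta\overline W}\overline\varphi=-\overline W$, $D^\circ_{\gamma\overline W}\overline\varphi=0$ and $D^\circ_{\gamma\overline W}\phi=0$ for the associated $\pi$-form $\phi=g(\overline\varphi,\cdot)$, where $D^\circ$ is the Berwald connection of $F$, and $\beta$, $\gamma$ are the horizontal and vertical lifts. Put $\Phi=\phi(\overline\eta)$, where $\overline\eta(u)=(u,u)$, and $\|\overline\varphi\|_g=g(\overline\varphi,\overline\varphi)$. Let $m\in\mathbb R$, $m\ne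 0,-1$, and let $\widehat F=F^{m+1}\Phi^{-m}$ on the set $\mathcal D_m\subseteq\mathcal D$ where $\Phi^{-m}$ is defined ($\Phi>0$; or $\Phi\neq0$ if $m$ is an integer). Then: (1) $\widehat F$ is a Finsler metric on the conic set $\{u\in\mathcal D_m:\widehat F(u)>0\}$ if and only if $$mF^2\|\overline\varphi\|_g-(m-1)\Phi^2\neq 0$$ at every point of that set; (2) at every point of $\mathcal D_m$, the metric tensor $\widehat g$ of $\widehat F$ (given by the same formula with $\widehat E=\tfrac12\widehat F^2$) is non-degenerate if and only if $mF^2\|\overline\varphi\|_g-(m-1)\Phi^2\ne0$ at that point. -/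

import Mathlib

open scoped Manifold ContDiff

noncomputable section

namespace Finsler

/-- The model vector space of an `n`-dimensional manifold. -/
abbrev Vec (n : ℕ) : Type := EuclideanSpace ℝ (Fin n)

/-! ### Tangent-bundle calculus in a coordinate domain

Points of a coordinate domain of the tangent bundle are pairs `z = (x, y) : Vec n × Vec n`, and so
are the tangent vectors of the tangent bundle at such a point. `L` is the coordinate expression of
an energy function and `Y` the one of a `π`-vector field (a section of the pullback bundle). -/

/-- The tangent structure `J = γ ∘ ρ`: `J (a, b) = (0, a)`. -/
def J (n : ℕ) : (Vec n × Vec n) →L[ℝ] (Vec n × Vec n) :=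
  (ContinuousLinearMap.inr ℝ (Vec n) (Vec n)).comp (ContinuousLinearMap.fst ℝ (Vec n) (Vec n))

/-- The one-form `d_J L = dL ∘ J`. -/
def dJ {n : ℕ} (L : Vec n × Vec n → ℝ) (z : Vec n × Vec n) : (Vec n × Vec n) →L[ℝ] ℝ :=
  (fderiv ℝ L z).comp (J n)

/-- The Hilbert two-form `d d_J L`:
`dθ (W, Z) = W (θ Z) - Z (θ W)` for constant `W`, `Z`, with `θ = d_J L`. -/
def hilbertForm {n : ℕ} (L : Vec n × Vec n → ℝ) (z : Vec n × Vec n) :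
    (Vec n × Vec n) →L[ℝ] (Vec n × Vec n) →L[ℝ] ℝ :=
  fderiv ℝ (dJ L) z - (fderiv ℝ (dJ L) z).flip

/-- The metric tensor `g (ρ W, ρ Z) = d d_J L (J W, Z)`, with `W = (X, 0)` and `Z = (Y, 0)`. -/
def localMetric {n : ℕ} (L : Vec n × Vec n → ℝ) (z : Vec n × Vec n) (X Y : Vec n) : ℝ :=
  hilbertForm L z (J n (X, 0)) (Y, 0)

/-- The geodesic spray `G`, the solution of `i_G d d_J L = - dL`
(unique where the Hilbert form has maximal rank). -/
def spray {n : ℕ} (L : Vec n × Vec n → ℝ) (z : Vec n × Vec n) : Vec n × Vec n :=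
  (hilbertForm L z).inverse (-(fderiv ℝ L z))

/-- The Barthel connection `Γ = [J, G]`, i.e. `Γ W = [J W, G] - J [W, G]`
(evaluated on constant vector fields `W`). -/
def barthel {n : ℕ} (L : Vec n × Vec n → ℝ) (z : Vec n × Vec n) :
    (Vec n × Vec n) →L[ℝ] (Vec n × Vec n) :=
  (fderiv ℝ (spray L) z).comp (J n) - (J n).comp (fderiv ℝ (spray L) z)

/-- The horizontal projector `h = (I + Γ) / 2`. -/
def horProj {n : ℕ} (L : Vec n × Vec n → ℝ) (z : Vec n × Vec n) :
    (Vec n × Vec n) →L[ℝ] (Vec n × Vec n) :=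
  (1 / 2 : ℝ) • (ContinuousLinearMap.id ℝ (Vec n × Vec n) + barthel L z)

/-- The vertical projector `v = (I - Γ) / 2`. -/
def verProj {n : ℕ} (L : Vec n × Vec n → ℝ) (z : Vec n × Vec n) :
    (Vec n × Vec n) →L[ℝ] (Vec n × Vec n) :=
  (1 / 2 : ℝ) • (ContinuousLinearMap.id ℝ (Vec n × Vec n) - barthel L z)

/-- The vertical lift `γ Y` of a `π`-vector field. -/
def verLift {n : ℕ} (Y : Vec n × Vec n → Vec n) (z : Vec n × Vec n) : Vec n × Vec n :=
  (0, Y z)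

/-- The horizontal lift `β Y` of a `π`-vector field. -/
def horLift {n : ℕ} (L : Vec n × Vec n → ℝ) (Y : Vec n × Vec n → Vec n) (z : Vec n × Vec n) :
    Vec n × Vec n :=
  horProj L z (Y z, 0)

/-- The horizontal Berwald derivative `γ (D_{β X} Y) = v [β X, γ Y]`, for `X` with constant
components (it is tensorial in `X`). -/
def berwaldHor {n : ℕ} (L : Vec n × Vec n → ℝ) (X : Vec n) (Y : Vec n × Vec n → Vec n)
    (z : Vec n × Vec n) : Vec n :=
  (verProj L z (VectorField.lieBracket ℝ (horLift L (fun _ => X)) (verLift Y) z)).2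

/-- The vertical Berwald derivative `D_{γ X} Y = ρ [γ X, β Y]`, for `X` with constant
components (it is tensorial in `X`). -/
def berwaldVer {n : ℕ} (L : Vec n × Vec n → ℝ) (X : Vec n) (Y : Vec n × Vec n → Vec n)
    (z : Vec n × Vec n) : Vec n :=
  (VectorField.lieBracket ℝ (verLift (fun _ => X)) (horLift L Y) z).1

/-- The vertical Berwald derivative `(D_{γ X} φ) (Z) = γ X · φ (Z) - φ (D_{γ X} Z)` of the
`π`-form `φ = g (Y, ·)`, for `X`, `Z` with constant components. -/
def berwaldVerForm {n : ℕ} (L : Vec n × Vec n → ℝ) (X : Vec n) (Y : Vec n × Vec n → Vec n)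
    (Z : Vec n) (z : Vec n × Vec n) : ℝ :=
  fderiv ℝ (fun z' => localMetric L z' (Y z') Z) z (0, X)
    - localMetric L z (Y z) (berwaldVer L X (fun _ => Z) z)

/-! ### Manifolds -/

section Manifold

variable {n : ℕ} {M : Type*} [TopologicalSpace M] [ChartedSpace (Vec n) M] [IsManifold (𝓡 n) ∞ M]

/-- The coordinates `(x, y)` of a point `w` of the tangent bundle in the natural chart
around `u`. -/
def coords (u w : TangentBundle (𝓡 n) M) : Vec n × Vec n :=
  extChartAt (𝓡 n).tangent u w

/-- The energy `F² / 2` in the natural chart around `u`. -/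
def energyIn (F : TangentBundle (𝓡 n) M → ℝ) (u : TangentBundle (𝓡 n) M)
    (z : Vec n × Vec n) : ℝ :=
  (1 / 2) * F ((extChartAt (𝓡 n).tangent u).symm z) ^ 2

/-- The components of a `π`-vector field `φ` in the natural chart around `u`. -/
def fieldIn (φ : (u : TangentBundle (𝓡 n) M) → TangentSpace (𝓡 n) u.proj)
    (u : TangentBundle (𝓡 n) M) (z : Vec n × Vec n) : Vec n :=
  (coords u ⟨((extChartAt (𝓡 n).tangent u).symm z).proj,
    φ ((extChartAt (𝓡 n).tangent u).symm z)⟩).2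

/-- The metric tensor of `F` at the point `u` of the tangent bundle. -/
def metric (F : TangentBundle (𝓡 n) M → ℝ) (u : TangentBundle (𝓡 n) M)
    (X Y : TangentSpace (𝓡 n) u.proj) : ℝ :=
  localMetric (energyIn F u) (coords u u) (coords u ⟨u.proj, X⟩).2 (coords u ⟨u.proj, Y⟩).2

/-- Non-degeneracy of the metric tensor of `F` at `u`. -/
def MetricNondegenerateAt (F : TangentBundle (𝓡 n) M → ℝ) (u : TangentBundle (𝓡 n) M) : Prop :=
  ∀ X : TangentSpace (𝓡 n) u.proj,
    (∀ Y : TangentSpace (𝓡 n) u.proj, metric F u Y X = 0) → X = 0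

/-- `F` is a Finsler metric on the open conic subset `D` of the slit tangent bundle
(a Finsler metric on the whole manifold when `D` is the slit tangent bundle). Only the values
of `F` on `D` matter. -/
structure IsFinslerMetricOn (F : TangentBundle (𝓡 n) M → ℝ)
    (D : Set (TangentBundle (𝓡 n) M)) : Prop where
  isOpen : IsOpen D
  slit : ∀ u ∈ D, u.snd ≠ 0
  conic : ∀ u ∈ D, ∀ t : ℝ, 0 < t → (⟨u.proj, t • u.snd⟩ : TangentBundle (𝓡 n) M) ∈ D
  nonneg : ∀ u ∈ D, 0 ≤ F u
  smooth : ContMDiffOn (𝓡 n).tangent 𝓘(ℝ, ℝ) ∞ F D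
  /-- The Lie derivative of `F` along the Liouville vector field, whose flow consists of the
  dilations of the fibres, is `F`. -/
  homogeneous : ∀ u ∈ D,
    HasDerivAt (fun t : ℝ => F (⟨u.proj, t • u.snd⟩ : TangentBundle (𝓡 n) M)) (F u) 1
  /-- The Hilbert two-form has maximal rank. -/
  maximalRank : ∀ u ∈ D, Function.Injective (hilbertForm (energyIn F u) (coords u u))

/-- `φ` is a concurrent `π`-vector field over `D` for the Finsler metric `F`: it is smooth and
non-vanishing, its Berwald derivatives are `D_{β X} φ = - X` and `D_{γ X} φ = 0`, and the
associated `π`-form `g (φ, ·)` is, like `φ` itself, independent of the directional argument. -/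
structure IsConcurrentOn (F : TangentBundle (𝓡 n) M → ℝ)
    (φ : (u : TangentBundle (𝓡 n) M) → TangentSpace (𝓡 n) u.proj)
    (D : Set (TangentBundle (𝓡 n) M)) : Prop where
  smooth : ContMDiffOn (𝓡 n).tangent (𝓡 n).tangent ∞
    (fun u => (⟨u.proj, φ u⟩ : TangentBundle (𝓡 n) M)) D
  ne_zero : ∀ u ∈ D, φ u ≠ 0
  hor : ∀ u ∈ D, ∀ X : Vec n, berwaldHor (energyIn F u) X (fieldIn φ u) (coords u u) = -X
  ver : ∀ u ∈ D, ∀ X : Vec n, berwaldVer (energyIn F u) X (fieldIn φ u) (coords u u) = 0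
  ver_form : ∀ u ∈ D, ∀ X Z : Vec n,
    berwaldVerForm (energyIn F u) X (fieldIn φ u) Z (coords u u) = 0

/-- The function `Φ = g (φ, η)`, where `η` is the tautological section `u ↦ u`. -/
def Phi (F : TangentBundle (𝓡 n) M → ℝ)
    (φ : (u : TangentBundle (𝓡 n) M) → TangentSpace (𝓡 n) u.proj)
    (u : TangentBundle (𝓡 n) M) : ℝ :=
  metric F u (φ u) u.snd

/-- The function `‖φ‖_g = g (φ, φ)`. -/
def gNorm (F : TangentBundle (𝓡 n) M → ℝ)
    (φ : (u : TangentBundle (𝓡 n) M) → TangentSpace (𝓡 n) u.proj)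
    (u : TangentBundle (𝓡 n) M) : ℝ :=
  metric F u (φ u) (φ u)

/-- The generalized Kropina change `F^(m+1) Φ^(-m)` of `F`. -/
def kropina (m : ℝ) (F : TangentBundle (𝓡 n) M → ℝ)
    (φ : (u : TangentBundle (𝓡 n) M) → TangentSpace (𝓡 n) u.proj)
    (u : TangentBundle (𝓡 n) M) : ℝ :=
  F u ^ (m + 1) * Phi F φ u ^ (-m)

/-- The part of `D` where the power `Φ^(-m)` is defined. -/
def kropinaDomain (m : ℝ) (F : TangentBundle (𝓡 n) M → ℝ)
    (φ : (u : TangentBundle (𝓡 n) M) → TangentSpace (𝓡 n) u.proj)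
    (D : Set (TangentBundle (𝓡 n) M)) : Set (TangentBundle (𝓡 n) M) :=
  {u | u ∈ D ∧ (0 < Phi F φ u ∨ (Phi F φ u ≠ 0 ∧ ∃ k : ℤ, m = k))}

end Manifold

end Finsler

end

/-!
The metric tensor of a Finsler metric `F` at a direction `y` is the Hessian of `E = F² / 2` along
the tangent space containing `y`, and its Hilbert form has maximal rank exactly when this Hessian
is non-degenerate (`injective_hilbertForm_iff`). So both claims are statements about functions on
a single tangent space, once `Φ` is known to be smooth (`contMDiffAt_Phi`, from the independence
of the metric tensor of the natural chart) and the changed metric to be positively homogeneous.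

*Concurrence.* By Euler's identity the first component of the geodesic spray is the tautological
section (`spray_fst`). Hence horizontal lifts project back to the lifted field, and vertical Berwald
derivatives are partial derivatives in the directional argument (`berwaldVer_eq`). For a concurrent
field `φ` both the components of `φ` and those of the form `g (φ, ·)` are therefore constant
to first order along the fibre; so `Φ`, which is `dE (φ)` along the fibre by Euler's identity,
has derivative `g (φ, ·)` and vanishing Hessian there (`IsConcurrentOn.hasFDerivAt_Phi`,
`IsConcurrentOn.fderiv_fderiv_Phi`).

*Hessian of the changed energy.* Consequently the Hessian of `F ^ (2 m + 2) Φ ^ (-2 m) / 2` is a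
nowhere zero multiple of
`q ⊗ q + (m + 1) (g / E - dE ⊗ dE / E²) + 2 m dΦ ⊗ dΦ / Φ²`, where `q = (m + 1) dE / E - 2 m dΦ / Φ`
(`fderiv_fderiv_kropinaEnergy`), with `dE = g (y, ·)` and `dΦ = g (φ, ·)`. This form only involves
`g` and the vectors `y` and `φ`, and linear algebra in their span gives the criterion
(`kropinaForm_nondegenerate_iff`). It uses `F > 0` on the whole domain, which is automatic: at a
zero of `F` the direction would lie in the kernel of `g` (`IsFinslerMetricOn.pos`).
-/

noncomputable section

namespace Finsler

open Set Filter Topology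

/-! ### Coordinate expressions of the Hilbert form and of the metric tensor -/

section Local

variable {n : ℕ} {L : Vec n × Vec n → ℝ} {z : Vec n × Vec n}

theorem contDiffAt_fderiv (hL : ContDiffAt ℝ ∞ L z) : ContDiffAt ℝ ∞ (fderiv ℝ L) z :=
  hL.fderiv_right (by simp)

theorem contDiffAt_dJ (hL : ContDiffAt ℝ ∞ L z) : ContDiffAt ℝ ∞ (dJ L) z :=
  (contDiffAt_fderiv hL).clm_comp contDiffAt_const

theorem contDiffAt_hilbertForm (hL : ContDiffAt ℝ ∞ L z) : ContDiffAt ℝ ∞ (hilbertForm L) z := by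
  have h : ContDiffAt ℝ ∞ (fderiv ℝ (dJ L)) z := (contDiffAt_dJ hL).fderiv_right (by simp)
  have hf : ContDiff ℝ ∞ (fun A : (Vec n × Vec n) →L[ℝ] (Vec n × Vec n) →L[ℝ] ℝ => A.flip) := by
    have hb : IsBoundedLinearMap ℝ
        (fun A : (Vec n × Vec n) →L[ℝ] (Vec n × Vec n) →L[ℝ] ℝ => A.flip) :=
      ⟨⟨fun _ _ => rfl, fun _ _ => rfl⟩, 1, one_pos, fun A => by simp⟩
    exact hb.contDiff
  exact h.sub (hf.contDiffAt.comp z h)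

theorem fderiv_dJ_apply (hL : ContDiffAt ℝ ∞ L z) (W Z : Vec n × Vec n) :
    fderiv ℝ (dJ L) z W Z = fderiv ℝ (fderiv ℝ L) z W (0, Z.1) := by
  have h := ((contDiffAt_fderiv hL).differentiableAt (by simp)).hasFDerivAt.clm_comp
    (hasFDerivAt_const (J n) z)
  have h' : HasFDerivAt (dJ L) _ z := h
  rw [h'.fderiv]
  simp [J]

theorem hilbertForm_apply (hL : ContDiffAt ℝ ∞ L z) (W Z : Vec n × Vec n) :
    hilbertForm L z W Z = fderiv ℝ (fderiv ℝ L) z W (0, Z.1)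
      - fderiv ℝ (fderiv ℝ L) z Z (0, W.1) := by
  simp [hilbertForm, fderiv_dJ_apply hL]

/-- The metric tensor is the Hessian of the energy in the directional argument. -/
theorem localMetric_eq (hL : ContDiffAt ℝ ∞ L z) (X Y : Vec n) :
    localMetric L z X Y = fderiv ℝ (fderiv ℝ L) z (0, X) (0, Y) := by
  have h0 : ((0, 0) : Vec n × Vec n) = 0 := rfl
  simp [localMetric, hilbertForm_apply hL, J, h0]

theorem fderiv_fderiv_symm {E : Type*} [NormedAddCommGroup E] [NormedSpace ℝ E] {f : E → ℝ} {x : E}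
    (hf : ContDiffAt ℝ ∞ f x) (v w : E) :
    fderiv ℝ (fderiv ℝ f) x v w = fderiv ℝ (fderiv ℝ f) x w v :=
  (hf.isSymmSndFDerivAt (by simpa using ENat.LEInfty.out)) v w

theorem hasFDerivAt_mk_right (x y : Vec n) :
    HasFDerivAt (fun y' : Vec n => (x, y')) (ContinuousLinearMap.inr ℝ (Vec n) (Vec n)) y :=
  hasFDerivAt_prodMk_right x y

/-- The fibre Hessian of `L` is the Hessian of its restriction to the fibre. -/
theorem fderiv_fderiv_vertical {x y : Vec n} (hL : ContDiffAt ℝ ∞ L (x, y)) (X Y : Vec n) :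
    fderiv ℝ (fderiv ℝ L) (x, y) (0, X) (0, Y)
      = fderiv ℝ (fderiv ℝ (fun y' => L (x, y'))) y X Y := by
  -- smoothness of infinite order at a point does not spread to a neighbourhood, order one does
  have h1 : ∀ᶠ y' in 𝓝 y, fderiv ℝ (fun y' => L (x, y')) y'
      = (fderiv ℝ L (x, y')).comp (ContinuousLinearMap.inr ℝ (Vec n) (Vec n)) := by
    have hc : ContinuousAt (fun y' : Vec n => (x, y')) y := by fun_prop
    filter_upwards [hc.eventually ((hL.of_le (m := 1) (by simp)).eventually (by simp))] with y' hy'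
    exact ((hy'.differentiableAt (by simp)).hasFDerivAt.comp y' (hasFDerivAt_mk_right x y')).fderiv
  have h2 := (((contDiffAt_fderiv hL).differentiableAt (by simp)).hasFDerivAt.comp y
    (hasFDerivAt_mk_right x y)).clm_comp
      (hasFDerivAt_const (ContinuousLinearMap.inr ℝ (Vec n) (Vec n)) y)
  rw [Filter.EventuallyEq.fderiv_eq h1]
  have h3 : fderiv ℝ (fun y' : Vec n => (fderiv ℝ L (x, y')).comp
    (ContinuousLinearMap.inr ℝ (Vec n) (Vec n))) y = _ := h2.fderiv
  rw [h3]
  simp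

theorem localMetric_eq_fibre {x y : Vec n} (hL : ContDiffAt ℝ ∞ L (x, y)) (X Y : Vec n) :
    localMetric L (x, y) X Y = fderiv ℝ (fderiv ℝ (fun y' => L (x, y'))) y X Y := by
  rw [localMetric_eq hL, fderiv_fderiv_vertical hL]

/-- The Hilbert form has maximal rank exactly when the metric tensor is non-degenerate. -/
theorem injective_hilbertForm_iff (hL : ContDiffAt ℝ ∞ L z) :
    Function.Injective (hilbertForm L z) ↔
      ∀ X : Vec n, (∀ Y : Vec n, localMetric L z Y X = 0) → X = 0 := by
  have h0 : ((0, 0) : Vec n × Vec n) = 0 := rfl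
  rw [injective_iff_map_eq_zero]
  constructor
  · intro h X hX
    have : hilbertForm L z (0, X) = 0 := by
      ext Z
      · have := hX Z
        rw [localMetric_eq hL, fderiv_fderiv_symm hL] at this
        simp [hilbertForm_apply hL, h0, this]
      · simp [hilbertForm_apply hL, h0]
    exact (Prod.ext_iff.1 (h _ this)).2
  · rintro h ⟨a, b⟩ hab
    have ha : a = 0 := h a fun Y => by
      have := congrArg (fun f => f (0, Y)) hab
      simp only [hilbertForm_apply hL, h0] at this
      rw [localMetric_eq hL]
      simpa using this
    subst ha
    have hb : b = 0 := h b fun Y => by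
      have := congrArg (fun f => f (Y, 0)) hab
      simp only [hilbertForm_apply hL, h0] at this
      rw [localMetric_eq hL, fderiv_fderiv_symm hL]
      simpa using this
    subst hb
    rfl

theorem isInvertible_hilbertForm (h : Function.Injective (hilbertForm L z)) :
    (hilbertForm L z).IsInvertible := by
  have hd : Module.finrank ℝ (Vec n × Vec n) = Module.finrank ℝ ((Vec n × Vec n) →L[ℝ] ℝ) := by
    rw [← (LinearMap.toContinuousLinearMap (𝕜 := ℝ) (E := Vec n × Vec n) (F' := ℝ)).finrank_eq]
    exact Subspace.dual_finrank_eq.symm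
  exact ⟨(LinearEquiv.ofInjectiveOfFinrankEq (hilbertForm L z).toLinearMap h
    hd).toContinuousLinearEquiv, by ext <;> rfl⟩

theorem contDiffAt_spray (hL : ContDiffAt ℝ ∞ L z) (h : Function.Injective (hilbertForm L z)) :
    ContDiffAt ℝ ∞ (spray L) z :=
  ((isInvertible_hilbertForm h).contDiffAt_map_inverse.comp z
    (contDiffAt_hilbertForm hL)).clm_apply (contDiffAt_fderiv hL).neg

theorem eventually_injective_hilbertForm (hL : ContDiffAt ℝ ∞ L z)
    (h : Function.Injective (hilbertForm L z)) :
    ∀ᶠ z' in 𝓝 z, Function.Injective (hilbertForm L z') := by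
  obtain ⟨e, he⟩ := isInvertible_hilbertForm h
  have := (contDiffAt_hilbertForm hL).continuousAt.eventually
    (he ▸ ContinuousLinearEquiv.nhds e)
  filter_upwards [this] with z' ⟨e', he'⟩
  rw [← he']
  exact e'.injective

/-- Differentiating Euler's identity in the direction of the fibre. -/
theorem fderiv_fderiv_euler {e : Vec n → ℝ} {y : Vec n} (he : ContDiffAt ℝ ∞ e y)
    (hE : ∀ᶠ y' in 𝓝 y, fderiv ℝ e y' y' = 2 * e y') (X : Vec n) :
    fderiv ℝ (fderiv ℝ e) y X y = fderiv ℝ e y X := by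
  have hd : ContDiffAt ℝ ∞ (fderiv ℝ e) y := he.fderiv_right (by simp)
  have h1 := (hd.differentiableAt (by simp)).hasFDerivAt.clm_apply (hasFDerivAt_id y)
  have h2 := ((he.differentiableAt (by simp)).hasFDerivAt.const_mul 2)
  have h3 := h1.unique (h2.congr_of_eventuallyEq hE)
  have h4 := congrArg (fun f => f X) h3
  simp at h4
  linarith


/-- The first component of the geodesic spray is the tautological section. -/
theorem spray_fst (hL : ContDiffAt ℝ ∞ L z) (h : Function.Injective (hilbertForm L z))
    (hE : ∀ᶠ z' in 𝓝 z, fderiv ℝ L z' (0, z'.2) = 2 * L z') : (spray L z).1 = z.2 := by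
  have h0 : ((0, 0) : Vec n × Vec n) = 0 := rfl
  have hS : hilbertForm L z (spray L z) = -fderiv ℝ L z := by
    obtain ⟨e, he⟩ := isInvertible_hilbertForm h
    rw [spray, ← he, ContinuousLinearMap.inverse_equiv]
    simp
  have hd := (contDiffAt_fderiv hL).differentiableAt (by simp)
  -- test `i_G d d_J L = - dL` against the vertical vectors `(0, Y)`
  refine sub_eq_zero.1 ((injective_hilbertForm_iff hL).1 h _ fun Y => ?_)
  -- Euler's identity differentiated in the direction `(0, Y)`
  have h1 := hd.hasFDerivAt.clm_apply
    ((ContinuousLinearMap.inr ℝ (Vec n) (Vec n)).comp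
      (ContinuousLinearMap.snd ℝ (Vec n) (Vec n))).hasFDerivAt
  have h2 := (hL.differentiableAt (by simp)).hasFDerivAt.const_mul 2
  have h3 := congrArg (fun f => f (0, Y)) (h1.unique (h2.congr_of_eventuallyEq hE))
  have h4 := congrArg (fun f => f (0, Y)) hS
  simp only [hilbertForm_apply hL, h0] at h4
  simp at h3 h4
  have h5 : ((0, (spray L z).1 - z.2) : Vec n × Vec n) = (0, (spray L z).1) - (0, z.2) := by simp
  rw [localMetric_eq hL, h5, map_sub]
  linarith

theorem barthel_apply_fst (hL : ∀ᶠ z' in 𝓝 z, ContDiffAt ℝ ∞ L z')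
    (h : Function.Injective (hilbertForm L z))
    (hE : ∀ᶠ z' in 𝓝 z, fderiv ℝ L z' (0, z'.2) = 2 * L z') (Y : Vec n) :
    (barthel L z (Y, 0)).1 = Y := by
  have hs := contDiffAt_spray hL.self_of_nhds h
  have h1 : (fun z' => (spray L z').1) =ᶠ[𝓝 z] Prod.snd := by
    filter_upwards [hL, eventually_injective_hilbertForm hL.self_of_nhds h,
      hE.eventually_nhds] with z' h1 h2 h3
    exact spray_fst h1 h2 h3
  have h2 := (hs.differentiableAt (by simp)).hasFDerivAt.fst.unique
    (hasFDerivAt_snd.congr_of_eventuallyEq h1)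
  have h3 := congrArg (fun f => f (0, Y)) h2
  simpa [barthel, J] using h3

variable {Y : Vec n × Vec n → Vec n}

theorem horLift_fst (hL : ∀ᶠ z' in 𝓝 z, ContDiffAt ℝ ∞ L z')
    (h : Function.Injective (hilbertForm L z))
    (hE : ∀ᶠ z' in 𝓝 z, fderiv ℝ L z' (0, z'.2) = 2 * L z') :
    (horLift L Y z).1 = Y z := by
  simp only [horLift, horProj, _root_.smul_apply, _root_.add_apply,
    Prod.smul_fst, Prod.fst_add, barthel_apply_fst hL h hE, ContinuousLinearMap.id_apply,
    ← two_smul ℝ (Y z), smul_smul]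
  norm_num

theorem differentiableAt_horLift (hL : ContDiffAt ℝ ∞ L z)
    (h : Function.Injective (hilbertForm L z)) (hY : DifferentiableAt ℝ Y z) :
    DifferentiableAt ℝ (horLift L Y) z := by
  have hs : ContDiffAt ℝ ∞ (fderiv ℝ (spray L)) z := (contDiffAt_spray hL h).fderiv_right (by simp)
  have hs' := hs.differentiableAt (by simp)
  have hb : DifferentiableAt ℝ (barthel L) z :=
    (hs'.clm_comp (differentiableAt_const _)).sub ((differentiableAt_const _).clm_comp hs')
  exact (((differentiableAt_const _).add hb).const_smul (1 / 2 : ℝ)).clm_apply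
    (hY.prodMk (differentiableAt_const _))

/-- The vertical Berwald derivative is the derivative of the components in the directional
argument. -/
theorem berwaldVer_eq (hL : ∀ᶠ z' in 𝓝 z, ContDiffAt ℝ ∞ L z')
    (h : Function.Injective (hilbertForm L z))
    (hE : ∀ᶠ z' in 𝓝 z, fderiv ℝ L z' (0, z'.2) = 2 * L z') (hY : DifferentiableAt ℝ Y z)
    (X : Vec n) : berwaldVer L X Y z = fderiv ℝ Y z (0, X) := by
  have hd := differentiableAt_horLift hL.self_of_nhds h hY
  have h1 : (fun z' => (horLift L Y z').1) =ᶠ[𝓝 z] Y := by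
    filter_upwards [hL.eventually_nhds, eventually_injective_hilbertForm hL.self_of_nhds h,
      hE.eventually_nhds] with z' h1 h2 h3
    exact horLift_fst h1 h2 h3
  have h2 := hd.hasFDerivAt.fst.unique (hY.hasFDerivAt.congr_of_eventuallyEq h1)
  have h3 : fderiv ℝ (verLift fun _ : Vec n × Vec n => X) z = 0 :=
    (hasFDerivAt_const ((0, X) : Vec n × Vec n) z).fderiv
  have h4 := congrArg (fun f => f (0, X)) h2
  simpa [berwaldVer, VectorField.lieBracket, h3, verLift] using h4

/-- Vertical derivatives of `π`-forms are taken componentwise. -/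
theorem berwaldVerForm_eq (hL : ∀ᶠ z' in 𝓝 z, ContDiffAt ℝ ∞ L z')
    (h : Function.Injective (hilbertForm L z))
    (hE : ∀ᶠ z' in 𝓝 z, fderiv ℝ L z' (0, z'.2) = 2 * L z') (X Z : Vec n) :
    berwaldVerForm L X Y Z z = fderiv ℝ (fun z' => localMetric L z' (Y z') Z) z (0, X) := by
  rw [berwaldVerForm, berwaldVer_eq hL h hE (differentiableAt_const Z)]
  have h0 : ((0, 0) : Vec n × Vec n) = 0 := rfl
  simp [localMetric, J, h0]

theorem contDiffAt_localMetric {X Y : Vec n × Vec n → Vec n} (hL : ContDiffAt ℝ ∞ L z)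
    (hX : ContDiffAt ℝ ∞ X z) (hY : ContDiffAt ℝ ∞ Y z) :
    ContDiffAt ℝ ∞ (fun z' => localMetric L z' (X z') (Y z')) z :=
  ((contDiffAt_hilbertForm hL).clm_apply (contDiffAt_const.prodMk hX)).clm_apply
    (hY.prodMk contDiffAt_const)

end Local

/-! ### The Kropina change on a fibre -/

section Fibre

variable {V : Type*} [NormedAddCommGroup V] [NormedSpace ℝ V]

/-- The logarithmic derivative of the changed energy `W = (f ^ (m + 1) * P ^ (-m))² / 2`, in terms
of the one of the energy `e = f² / 2`. -/
theorem hasFDerivAt_kropinaEnergy {m : ℝ} {f P e W : V → ℝ} {y : V}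
    (he : ∀ y', e y' = (1 / 2) * f y' ^ 2)
    (hW : ∀ y', W y' = (1 / 2) * (f y' ^ (m + 1) * P y' ^ (-m)) ^ 2)
    (hf : DifferentiableAt ℝ f y) (hP : DifferentiableAt ℝ P y) (hf0 : f y ≠ 0) (hP0 : P y ≠ 0) :
    HasFDerivAt W (W y • (((m + 1) / e y) • fderiv ℝ e y - (2 * m / P y) • fderiv ℝ P y)) y := by
  obtain rfl : e = _ := funext he
  obtain rfl : W = _ := funext hW
  have he : HasFDerivAt (fun y' => (1 / 2) * f y' ^ 2) _ y :=
    (hf.hasFDerivAt.pow 2).const_mul (1 / 2)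
  have h1 := hf.hasFDerivAt.rpow_const (p := m + 1) (Or.inl hf0)
  have h2 := hP.hasFDerivAt.rpow_const (p := -m) (Or.inl hP0)
  refine (((h1.mul h2).pow 2).const_mul (1 / 2)).congr_fderiv ?_
  rw [he.fderiv]
  ext X
  rw [Real.rpow_sub_one hf0, Real.rpow_sub_one hP0]
  simp
  field_simp
  ring

/-- The Hessian of the changed energy, when the one-form `dP` is constant to first order. -/
theorem fderiv_fderiv_kropinaEnergy {m : ℝ} {f P e W : V → ℝ} {y : V}
    (he : ∀ y', e y' = (1 / 2) * f y' ^ 2)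
    (hW : ∀ y', W y' = (1 / 2) * (f y' ^ (m + 1) * P y' ^ (-m)) ^ 2)
    (hf : ContDiffAt ℝ ∞ f y) (hP : ContDiffAt ℝ ∞ P y) (hf0 : f y ≠ 0) (hP0 : P y ≠ 0)
    (hPP : fderiv ℝ (fderiv ℝ P) y = 0) (X Z : V) :
    fderiv ℝ (fderiv ℝ W) y X Z = W y *
        (((m + 1) / e y * fderiv ℝ e y X - 2 * m / P y * fderiv ℝ P y X)
            * ((m + 1) / e y * fderiv ℝ e y Z - 2 * m / P y * fderiv ℝ P y Z)
          + (m + 1) / e y * fderiv ℝ (fderiv ℝ e) y X Z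
          - (m + 1) / e y ^ 2 * fderiv ℝ e y X * fderiv ℝ e y Z
          + 2 * m / P y ^ 2 * fderiv ℝ P y X * fderiv ℝ P y Z) := by
  have hes : ContDiffAt ℝ ∞ e y := by
    obtain rfl : e = _ := funext he
    exact contDiffAt_const.mul (hf.pow 2)
  have he0 : e y ≠ 0 := by rw [he]; positivity
  have hev : fderiv ℝ W =ᶠ[𝓝 y] fun y' => W y' •
      (((m + 1) * (e y')⁻¹) • fderiv ℝ e y' - (2 * m * (P y')⁻¹) • fderiv ℝ P y') := by
    filter_upwards [(hf.of_le (m := 1) (by simp)).eventually (by simp),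
      (hP.of_le (m := 1) (by simp)).eventually (by simp), hf.continuousAt.eventually_ne hf0,
      hP.continuousAt.eventually_ne hP0] with y' h1 h2 h3 h4
    exact (hasFDerivAt_kropinaEnergy he hW (h1.differentiableAt (by simp))
      (h2.differentiableAt (by simp)) h3 h4).fderiv
  have hW' := hasFDerivAt_kropinaEnergy he hW (hf.differentiableAt (by simp))
    (hP.differentiableAt (by simp)) hf0 hP0
  have hde := ((hes.fderiv_right (m := ∞) (by simp)).differentiableAt (by simp)).hasFDerivAt
  have hdP := ((hP.fderiv_right (m := ∞) (by simp)).differentiableAt (by simp)).hasFDerivAt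
  have hie := ((hasDerivAt_inv he0).comp_hasFDerivAt y
    (hes.differentiableAt (by simp)).hasFDerivAt).const_mul (m + 1)
  have hiP := ((hasDerivAt_inv hP0).comp_hasFDerivAt y
    (hP.differentiableAt (by simp)).hasFDerivAt).const_mul (2 * m)
  have hfin := ((hW'.smul ((hie.smul hde).sub (hiP.smul hdP))).congr_of_eventuallyEq hev).fderiv
  rw [hfin, hPP]
  simp
  ring

/-- Non-degeneracy of a rank-two modification of a multiple of a non-degenerate symmetric form `g`.
With `S = g(y, y)`, `Φ = g(φ, y)` and `p = g(φ, φ)`, testing a kernel vector `X` against `y` and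
`φ` gives `(m + 1) Φ g(X, y) = m S g(X, φ)` and `(m S p - (m - 1) Φ²) g(X, φ) = 0`; conversely,
when the factor vanishes, `2 Φ y - S φ` is a kernel vector, non-zero because its product with `y`
is `S Φ`. -/
theorem kropinaForm_nondegenerate_iff (g : V →L[ℝ] V →L[ℝ] ℝ) (hs : ∀ X Y, g X Y = g Y X)
    (hg : ∀ X, (∀ Y, g Y X = 0) → X = 0) {y φ : V} {m W : ℝ} (hm1 : m ≠ -1)
    (hW : W ≠ 0) (hS : g y y ≠ 0) (hP : g φ y ≠ 0) :
    (∀ X, (∀ Y, W *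
        (((m + 1) / ((1 / 2) * g y y) * g Y y - 2 * m / g φ y * g Y φ)
          * ((m + 1) / ((1 / 2) * g y y) * g X y - 2 * m / g φ y * g X φ)
          + (m + 1) / ((1 / 2) * g y y) * g Y X
          - (m + 1) / ((1 / 2) * g y y) ^ 2 * g Y y * g X y
          + 2 * m / g φ y ^ 2 * g Y φ * g X φ) = 0) → X = 0) ↔
      m * g y y * g φ φ - (m - 1) * g φ y ^ 2 ≠ 0 := by
  have hm1' : m + 1 ≠ 0 := fun h => hm1 (by linarith)
  have hyφ : g y φ = g φ y := hs _ _
  constructor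
  · intro h hK
    have hX := h ((2 * g φ y) • y - g y y • φ) fun Y => by
      simp only [map_sub, map_smul, _root_.sub_apply, _root_.smul_apply, smul_eq_mul, hyφ]
      have hp : m * (2 * g φ y * g φ y - g y y * g φ φ) = (m + 1) * g φ y ^ 2 := by
        linear_combination -hK
      rw [← sub_eq_zero] at hp
      refine Eq.trans ?_ (mul_eq_zero_of_right (W * (2 * g Y φ / g φ y ^ 2
        - 2 / g φ y * ((m + 1) / ((1 / 2) * g y y) * g Y y - 2 * m / g φ y * g Y φ))) hp)
      field_simp
      ring
    have h1 : g ((2 * g φ y) • y - g y y • φ) y = g y y * g φ y := by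
      simp only [map_sub, map_smul, _root_.sub_apply, _root_.smul_apply, smul_eq_mul]
      ring
    rw [hX] at h1
    simp [hS, hP] at h1
  · intro hK X hX
    have hX' := fun Y => (mul_eq_zero.1 (hX Y)).resolve_left hW
    have h1 := hX' y
    have h2 := hX' φ
    rw [hyφ, hs y X] at h1
    rw [hs φ X] at h2
    have e1 : (m + 1) * g φ y * g X y = m * g y y * g X φ := by
      field_simp at h1
      linear_combination h1 / 2
    have e2 : g X φ * (m * g y y * g φ φ - (m - 1) * g φ y ^ 2) = 0 := by
      -- with this value of `g X y` the logarithmic derivative of the changed energy vanishes on `X`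
      have ha : g X y = m * g y y * g X φ / ((m + 1) * g φ y) := by field_simp; linarith
      rw [ha] at h2
      field_simp at h2
      linear_combination h2 / 2
    have hb : g X φ = 0 := (mul_eq_zero.1 e2).resolve_right hK
    have ha : g X y = 0 := by
      rw [hb, mul_zero] at e1
      exact (mul_eq_zero.1 e1).resolve_left (mul_ne_zero hm1' hP)
    refine hg X fun Y => ?_
    have h3 := hX' Y
    rw [ha, hb] at h3
    simpa [hm1', hS] using h3

end Fibre

/-! ### Natural charts of the tangent bundle -/

section Charts

variable {n : ℕ} {M : Type*} [TopologicalSpace M] [ChartedSpace (Vec n) M] [IsManifold (𝓡 n) ∞ M]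

theorem coords_mk (u : TangentBundle (𝓡 n) M) (q : M) (X : Vec n) :
    coords u (⟨q, X⟩ : TangentBundle (𝓡 n) M)
      = (extChartAt (𝓡 n) u.proj q, tangentCoordChange (𝓡 n) q u.proj q X) := rfl

theorem extChartAt_tangent_symm (u : TangentBundle (𝓡 n) M) (z : Vec n × Vec n) :
    (extChartAt (𝓡 n).tangent u).symm z =
      (⟨(extChartAt (𝓡 n) u.proj).symm z.1,
        tangentCoordChange (𝓡 n) u.proj ((extChartAt (𝓡 n) u.proj).symm z.1)
          ((extChartAt (𝓡 n) u.proj).symm z.1) z.2⟩ : TangentBundle (𝓡 n) M) := rfl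

theorem mem_extChartAt_tangent_source {u w : TangentBundle (𝓡 n) M} :
    w ∈ (extChartAt (𝓡 n).tangent u).source ↔ w.proj ∈ (extChartAt (𝓡 n) u.proj).source := by
  rw [extChartAt_source, extChartAt_source]
  simp

theorem mem_extChartAt_tangent_target {u : TangentBundle (𝓡 n) M} {z : Vec n × Vec n} :
    z ∈ (extChartAt (𝓡 n).tangent u).target ↔ z.1 ∈ (extChartAt (𝓡 n) u.proj).target := by
  rw [FiberBundle.extChartAt_target]
  simp only [mem_prod, mem_univ, and_true, mem_inter_iff, mem_preimage,
    TangentBundle.trivializationAt_baseSet, and_iff_left_iff_imp]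
  intro h
  rw [← extChartAt_source (𝓡 n)]
  exact (extChartAt (𝓡 n) u.proj).map_target h

theorem coords_self_fibre (u : TangentBundle (𝓡 n) M) (y : Vec n) :
    coords u (⟨u.proj, y⟩ : TangentBundle (𝓡 n) M) = (extChartAt (𝓡 n) u.proj u.proj, y) := by
  rw [coords_mk, tangentCoordChange_self (mem_extChartAt_source _)]

/-- On the fibre through its base point, the natural chart is the identity. -/
theorem extChartAt_tangent_symm_self (u : TangentBundle (𝓡 n) M) (y : Vec n) :
    (extChartAt (𝓡 n).tangent u).symm (extChartAt (𝓡 n) u.proj u.proj, y)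
      = (⟨u.proj, y⟩ : TangentBundle (𝓡 n) M) := by
  rw [← coords_self_fibre]
  exact (extChartAt (𝓡 n).tangent u).left_inv
    (mem_extChartAt_tangent_source.2 (mem_extChartAt_source _))

/-- The linear change of coordinates recovers a tangent vector from its components. -/
theorem tangentCoordChange_coords {u : TangentBundle (𝓡 n) M} {q : M}
    (hq : q ∈ (extChartAt (𝓡 n) u.proj).source) (X : Vec n) :
    tangentCoordChange (𝓡 n) u.proj q q (coords u (⟨q, X⟩ : TangentBundle (𝓡 n) M)).2 = X := by
  rw [coords_mk, tangentCoordChange_comp ⟨⟨mem_extChartAt_source _, hq⟩, mem_extChartAt_source _⟩,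
    tangentCoordChange_self (mem_extChartAt_source _)]

theorem isOpen_extChartAt_tangent_target (u : TangentBundle (𝓡 n) M) :
    IsOpen (extChartAt (𝓡 n).tangent u).target := isOpen_extChartAt_target u

/-- The coordinate expression of a smooth function is smooth. -/
theorem contDiffAt_comp_symm {f : TangentBundle (𝓡 n) M → ℝ} {u : TangentBundle (𝓡 n) M}
    {z : Vec n × Vec n} (hz : z ∈ (extChartAt (𝓡 n).tangent u).target)
    (hf : ContMDiffAt (𝓡 n).tangent 𝓘(ℝ, ℝ) ∞ f ((extChartAt (𝓡 n).tangent u).symm z)) :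
    ContDiffAt ℝ ∞ (fun z' => f ((extChartAt (𝓡 n).tangent u).symm z')) z := by
  rw [← contMDiffAt_iff_contDiffAt]
  exact hf.comp z ((contMDiffOn_extChartAt_symm u).contMDiffAt
    ((isOpen_extChartAt_tangent_target u).mem_nhds hz))

theorem contDiffAt_energyIn {F : TangentBundle (𝓡 n) M → ℝ} {u : TangentBundle (𝓡 n) M}
    {z : Vec n × Vec n} (hz : z ∈ (extChartAt (𝓡 n).tangent u).target)
    (hF : ContMDiffAt (𝓡 n).tangent 𝓘(ℝ, ℝ) ∞ F ((extChartAt (𝓡 n).tangent u).symm z)) :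
    ContDiffAt ℝ ∞ (energyIn F u) z :=
  contDiffAt_const.mul ((contDiffAt_comp_symm hz hF).pow 2)

/-- The energy `F² / 2` on the tangent space at `p`, which is `Vec n` as a type; this identification
is the one of the natural charts around the points over `p`. -/
def fibreEnergy (F : TangentBundle (𝓡 n) M → ℝ) (p : M) (y : Vec n) : ℝ :=
  (1 / 2) * F (⟨p, y⟩ : TangentBundle (𝓡 n) M) ^ 2

/-- A `π`-vector field restricted to the tangent space at `p`, as a map from `Vec n` to itself. -/
def fibreField (φ : (u : TangentBundle (𝓡 n) M) → TangentSpace (𝓡 n) u.proj) (p : M)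
    (y : Vec n) : Vec n :=
  φ (⟨p, y⟩ : TangentBundle (𝓡 n) M)

theorem energyIn_self_fibre (F : TangentBundle (𝓡 n) M → ℝ) (u : TangentBundle (𝓡 n) M)
    (y : Vec n) : energyIn F u (extChartAt (𝓡 n) u.proj u.proj, y) = fibreEnergy F u.proj y := by
  rw [energyIn, extChartAt_tangent_symm_self, fibreEnergy]

theorem fieldIn_self_fibre (φ : (u : TangentBundle (𝓡 n) M) → TangentSpace (𝓡 n) u.proj)
    (u : TangentBundle (𝓡 n) M) (y : Vec n) :
    fieldIn φ u (extChartAt (𝓡 n) u.proj u.proj, y) = fibreField φ u.proj y := by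
  rw [fieldIn, extChartAt_tangent_symm_self]
  exact congrArg Prod.snd (coords_self_fibre u (φ ⟨u.proj, y⟩))

theorem mem_target_self_fibre (u : TangentBundle (𝓡 n) M) (y : Vec n) :
    ((extChartAt (𝓡 n) u.proj u.proj, y) : Vec n × Vec n)
      ∈ (extChartAt (𝓡 n).tangent u).target :=
  mem_extChartAt_tangent_target.2 (mem_extChartAt_target _)

variable {F : TangentBundle (𝓡 n) M → ℝ}

theorem contDiffAt_fibre {f : TangentBundle (𝓡 n) M → ℝ} {p : M} {y : Vec n}
    (hf : ContMDiffAt (𝓡 n).tangent 𝓘(ℝ, ℝ) ∞ f (⟨p, y⟩ : TangentBundle (𝓡 n) M)) :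
    ContDiffAt ℝ ∞ (fun y' : Vec n => f (⟨p, y'⟩ : TangentBundle (𝓡 n) M)) y := by
  have h := contDiffAt_comp_symm (u := ⟨p, y⟩) (mem_target_self_fibre ⟨p, y⟩ y)
    (by rwa [extChartAt_tangent_symm_self])
  have h2 := h.comp y (contDiffAt_const.prodMk contDiffAt_id)
  refine h2.congr_of_eventuallyEq (Eventually.of_forall fun y' => ?_)
  exact congrArg f (extChartAt_tangent_symm_self ⟨p, y⟩ y').symm

theorem contDiffAt_fibreEnergy {p : M} {y : Vec n}
    (hF : ContMDiffAt (𝓡 n).tangent 𝓘(ℝ, ℝ) ∞ F (⟨p, y⟩ : TangentBundle (𝓡 n) M)) :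
    ContDiffAt ℝ ∞ (fibreEnergy F p) y :=
  contDiffAt_const.mul ((contDiffAt_fibre hF).pow 2)

/-- The metric tensor is the Hessian of the energy on the tangent space. -/
theorem metric_eq {p : M} {y : Vec n}
    (hF : ContMDiffAt (𝓡 n).tangent 𝓘(ℝ, ℝ) ∞ F (⟨p, y⟩ : TangentBundle (𝓡 n) M)) (X Y : Vec n) :
    metric F (⟨p, y⟩ : TangentBundle (𝓡 n) M) X Y
      = fderiv ℝ (fderiv ℝ (fibreEnergy F p)) y X Y := by
  have hL := contDiffAt_energyIn (u := ⟨p, y⟩) (mem_target_self_fibre ⟨p, y⟩ y)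
    (by rwa [extChartAt_tangent_symm_self])
  have h1 : ∀ Z : Vec n, coords (⟨p, y⟩ : TangentBundle (𝓡 n) M) ⟨p, Z⟩ = _ :=
    coords_self_fibre ⟨p, y⟩
  have h2 : metric F (⟨p, y⟩ : TangentBundle (𝓡 n) M) X Y = localMetric
      (energyIn F ⟨p, y⟩) (coords (⟨p, y⟩ : TangentBundle (𝓡 n) M) ⟨p, y⟩)
      (coords (⟨p, y⟩ : TangentBundle (𝓡 n) M) ⟨p, X⟩).2
      (coords (⟨p, y⟩ : TangentBundle (𝓡 n) M) ⟨p, Y⟩).2 := rfl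
  have h3 : (fun y' => energyIn F ⟨p, y⟩ (extChartAt (𝓡 n) p p, y')) = fibreEnergy F p :=
    funext (energyIn_self_fibre F ⟨p, y⟩)
  rw [h2, h1, h1, h1, ← h3]
  exact localMetric_eq_fibre hL X Y

/-- Chain rule for the Hessian under a linear change of variables. -/
theorem fderiv_fderiv_comp_clm {f : Vec n → ℝ} {B : Vec n →L[ℝ] Vec n} {y : Vec n}
    (hf : ContDiffAt ℝ ∞ f (B y)) (X Y : Vec n) :
    fderiv ℝ (fderiv ℝ fun y' => f (B y')) y X Y = fderiv ℝ (fderiv ℝ f) (B y) (B X) (B Y) := by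
  have h1 : fderiv ℝ (fun y' => f (B y')) =ᶠ[𝓝 y] fun y' => (fderiv ℝ f (B y')).comp B := by
    filter_upwards [B.continuous.continuousAt.eventually
      ((hf.of_le (m := 1) (by simp)).eventually (by simp))] with y' hy'
    exact ((hy'.differentiableAt (by simp)).hasFDerivAt.comp y' B.hasFDerivAt).fderiv
  have h2 := ((((hf.fderiv_right (m := ∞) (by simp)).differentiableAt
    (by simp)).hasFDerivAt.comp y B.hasFDerivAt).clm_comp
      (hasFDerivAt_const B y)).congr_of_eventuallyEq h1
  rw [h2.fderiv]
  simp

/-- The metric tensor does not depend on the natural chart it is computed in. -/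
theorem localMetric_energyIn {u : TangentBundle (𝓡 n) M} {z : Vec n × Vec n} {q : M}
    (hz : z ∈ (extChartAt (𝓡 n).tangent u).target) (hq : (extChartAt (𝓡 n) u.proj).symm z.1 = q)
    (hF : ContMDiffAt (𝓡 n).tangent 𝓘(ℝ, ℝ) ∞ F ((extChartAt (𝓡 n).tangent u).symm z))
    (X Y : Vec n) :
    localMetric (energyIn F u) z X Y =
      metric F (⟨q, tangentCoordChange (𝓡 n) u.proj q q z.2⟩ : TangentBundle (𝓡 n) M)
        (tangentCoordChange (𝓡 n) u.proj q q X) (tangentCoordChange (𝓡 n) u.proj q q Y) := by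
  subst hq
  have hL := contDiffAt_energyIn hz hF
  rw [extChartAt_tangent_symm] at hF
  rw [metric_eq hF, localMetric_eq_fibre (x := z.1) (y := z.2) hL]
  exact fderiv_fderiv_comp_clm (contDiffAt_fibreEnergy hF) X Y

/-- `Φ` in the natural chart around `u`. -/
theorem Phi_eq_localMetric {φ : (u : TangentBundle (𝓡 n) M) → TangentSpace (𝓡 n) u.proj}
    {u w : TangentBundle (𝓡 n) M} (hw : w ∈ (extChartAt (𝓡 n).tangent u).source)
    (hF : ContMDiffAt (𝓡 n).tangent 𝓘(ℝ, ℝ) ∞ F w) :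
    Phi F φ w = localMetric (energyIn F u) (coords u w) (fieldIn φ u (coords u w))
      (coords u w).2 := by
  have hs : (extChartAt (𝓡 n).tangent u).symm (coords u w) = w :=
    (extChartAt (𝓡 n).tangent u).left_inv hw
  have ht : coords u w ∈ (extChartAt (𝓡 n).tangent u).target :=
    (extChartAt (𝓡 n).tangent u).map_source hw
  have hw' := mem_extChartAt_tangent_source.1 hw
  obtain ⟨q, y⟩ := w
  have h : ∀ Y P : Vec n, Y = y → P = φ ⟨q, y⟩ →
      Phi F φ ⟨q, y⟩ = metric F (⟨q, Y⟩ : TangentBundle (𝓡 n) M) P Y := by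
    rintro _ _ rfl rfl
    rfl
  rw [localMetric_energyIn (q := q) ht ((extChartAt (𝓡 n) u.proj).left_inv hw') (by rwa [hs]),
    fieldIn, hs]
  exact h _ _ (tangentCoordChange_coords hw' y) (tangentCoordChange_coords hw' (φ ⟨q, y⟩))

theorem contDiffAt_fieldIn {φ : (u : TangentBundle (𝓡 n) M) → TangentSpace (𝓡 n) u.proj}
    {u : TangentBundle (𝓡 n) M} {z : Vec n × Vec n}
    (hz : z ∈ (extChartAt (𝓡 n).tangent u).target)
    (hφ : ContMDiffAt (𝓡 n).tangent (𝓡 n).tangent ∞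
      (fun u => (⟨u.proj, φ u⟩ : TangentBundle (𝓡 n) M)) ((extChartAt (𝓡 n).tangent u).symm z)) :
    ContDiffAt ℝ ∞ (fieldIn φ u) z := by
  have hsrc := (extChartAt (𝓡 n).tangent u).map_target hz
  have h1 : ContMDiffAt 𝓘(ℝ, Vec n × Vec n) (𝓡 n).tangent ∞ _ z := hφ.comp z
    ((contMDiffOn_extChartAt_symm u).contMDiffAt ((isOpen_extChartAt_tangent_target u).mem_nhds hz))
  have h2 : ContMDiffAt (𝓡 n).tangent 𝓘(ℝ, Vec n × Vec n) ∞ (extChartAt (𝓡 n).tangent u)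
      (⟨((extChartAt (𝓡 n).tangent u).symm z).proj, φ ((extChartAt (𝓡 n).tangent u).symm z)⟩ :
        TangentBundle (𝓡 n) M) := by
    refine contMDiffAt_extChartAt' ?_
    rw [← extChartAt_source (𝓡 n).tangent]
    rw [mem_extChartAt_tangent_source] at hsrc ⊢
    exact hsrc
  exact (h2.comp z h1).contDiffAt.snd

theorem contMDiffAt_Phi {φ : (u : TangentBundle (𝓡 n) M) → TangentSpace (𝓡 n) u.proj}
    {u : TangentBundle (𝓡 n) M}
    (hF : ∀ᶠ w in 𝓝 u, ContMDiffAt (𝓡 n).tangent 𝓘(ℝ, ℝ) ∞ F w)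
    (hφ : ContMDiffAt (𝓡 n).tangent (𝓡 n).tangent ∞
      (fun u => (⟨u.proj, φ u⟩ : TangentBundle (𝓡 n) M)) u) :
    ContMDiffAt (𝓡 n).tangent 𝓘(ℝ, ℝ) ∞ (Phi F φ) u := by
  have hs : (extChartAt (𝓡 n).tangent u).symm (coords u u) = u := extChartAt_to_inv u
  have ht : coords u u ∈ (extChartAt (𝓡 n).tangent u).target := mem_extChartAt_target u
  have h1 : ContDiffAt ℝ ∞ (fun z => localMetric (energyIn F u) z (fieldIn φ u z) z.2)
      (coords u u) :=
    contDiffAt_localMetric (contDiffAt_energyIn ht (by rw [hs]; exact hF.self_of_nhds))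
      (contDiffAt_fieldIn ht (by rwa [hs])) contDiffAt_snd
  have h2 : ContMDiffAt (𝓡 n).tangent 𝓘(ℝ, Vec n × Vec n) ∞ (coords u) u :=
    contMDiffAt_extChartAt
  refine (h1.contMDiffAt.comp u h2).congr_of_eventuallyEq ?_
  filter_upwards [hF, extChartAt_source_mem_nhds (I := (𝓡 n).tangent) u] with w hw hws
  exact Phi_eq_localMetric hws hw

end Charts

/-! ### Finsler metrics and concurrent fields on a fibre -/

section FinslerFibre

variable {n : ℕ} {M : Type*} [TopologicalSpace M] [ChartedSpace (Vec n) M] [IsManifold (𝓡 n) ∞ M]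
  {F : TangentBundle (𝓡 n) M → ℝ} {D : Set (TangentBundle (𝓡 n) M)}
  {φ : (u : TangentBundle (𝓡 n) M) → TangentSpace (𝓡 n) u.proj}

theorem IsFinslerMetricOn.contMDiffAt (hF : IsFinslerMetricOn F D) {u : TangentBundle (𝓡 n) M}
    (hu : u ∈ D) : ContMDiffAt (𝓡 n).tangent 𝓘(ℝ, ℝ) ∞ F u :=
  hF.smooth.contMDiffAt (hF.isOpen.mem_nhds hu)

theorem eventually_fibre_mem (hD : IsOpen D) {p : M} {y : Vec n}
    (hy : (⟨p, y⟩ : TangentBundle (𝓡 n) M) ∈ D) :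
    ∀ᶠ y' : Vec n in 𝓝 y, (⟨p, y'⟩ : TangentBundle (𝓡 n) M) ∈ D :=
  (FiberBundle.continuous_totalSpaceMk (Vec n) (TangentSpace (𝓡 n) : M → Type _)
    p).continuousAt.eventually (hD.mem_nhds hy)

theorem eventually_symm_mem (hD : IsOpen D) {u : TangentBundle (𝓡 n) M} (hu : u ∈ D) :
    ∀ᶠ z in 𝓝 (coords u u), z ∈ (extChartAt (𝓡 n).tangent u).target ∧
      (extChartAt (𝓡 n).tangent u).symm z ∈ D := by
  have h := (continuousAt_extChartAt_symm (I := (𝓡 n).tangent) u).eventually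
    (by rw [extChartAt_to_inv]; exact hD.mem_nhds hu)
  filter_upwards [h, (isOpen_extChartAt_tangent_target u).mem_nhds (mem_extChartAt_target u)]
    with z h1 h2 using ⟨h2, h1⟩

theorem IsFinslerMetricOn.hasDerivAt_energy_ray (hF : IsFinslerMetricOn F D)
    {u : TangentBundle (𝓡 n) M} (hu : u ∈ D) :
    HasDerivAt (fun t : ℝ => (1 / 2) * F (⟨u.proj, t • u.snd⟩ : TangentBundle (𝓡 n) M) ^ 2)
      (2 * ((1 / 2) * F u ^ 2)) 1 := by
  have h1 : F (⟨u.proj, (1 : ℝ) • u.snd⟩ : TangentBundle (𝓡 n) M) = F u := by rw [one_smul]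
  refine (((hF.homogeneous u hu).pow 2).const_mul (1 / 2)).congr_deriv ?_
  rw [h1]
  push_cast
  ring

/-- Euler's identity for the energy in a natural chart. -/
theorem IsFinslerMetricOn.euler_energyIn (hF : IsFinslerMetricOn F D)
    {u : TangentBundle (𝓡 n) M} {z : Vec n × Vec n}
    (hz : z ∈ (extChartAt (𝓡 n).tangent u).target)
    (hzD : (extChartAt (𝓡 n).tangent u).symm z ∈ D) :
    fderiv ℝ (energyIn F u) z (0, z.2) = 2 * energyIn F u z := by
  have hL := (contDiffAt_energyIn hz (hF.contMDiffAt hzD)).differentiableAt (by simp)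
  have h1 : HasDerivAt (fun t : ℝ => ((z.1, t • z.2) : Vec n × Vec n)) (0, (1 : ℝ) • z.2) 1 :=
    (hasDerivAt_const 1 z.1).prodMk ((hasDerivAt_id 1).smul_const z.2)
  have h2 := HasFDerivAt.comp_hasDerivAt (f := fun t : ℝ => ((z.1, t • z.2) : Vec n × Vec n)) 1
    (by simpa using hL.hasFDerivAt) h1
  have h4 : (energyIn F u ∘ fun t : ℝ => ((z.1, t • z.2) : Vec n × Vec n)) =
      fun t : ℝ => (1 / 2) * F (⟨((extChartAt (𝓡 n).tangent u).symm z).proj,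
        t • ((extChartAt (𝓡 n).tangent u).symm z).snd⟩ : TangentBundle (𝓡 n) M) ^ 2 := by
    funext t
    simp only [Function.comp_apply, energyIn, extChartAt_tangent_symm, map_smul]
    rfl
  rw [h4, one_smul] at h2
  exact h2.unique (hF.hasDerivAt_energy_ray hzD)

/-- Euler's identity for the energy on a tangent space. -/
theorem IsFinslerMetricOn.euler_fibreEnergy (hF : IsFinslerMetricOn F D) {p : M} {y : Vec n}
    (hy : (⟨p, y⟩ : TangentBundle (𝓡 n) M) ∈ D) :
    fderiv ℝ (fibreEnergy F p) y y = 2 * fibreEnergy F p y := by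
  have hL := (contDiffAt_fibreEnergy (hF.contMDiffAt hy)).differentiableAt (by simp)
  have h1 : HasDerivAt (fun t : ℝ => t • y) ((1 : ℝ) • y) 1 := (hasDerivAt_id 1).smul_const y
  have h2 := HasFDerivAt.comp_hasDerivAt (f := fun t : ℝ => t • y) 1
    (by simpa using hL.hasFDerivAt) h1
  rw [one_smul] at h2
  exact h2.unique (hF.hasDerivAt_energy_ray hy)

theorem IsFinslerMetricOn.contDiffAt_fibreEnergy (hF : IsFinslerMetricOn F D) {p : M} {y : Vec n}
    (hy : (⟨p, y⟩ : TangentBundle (𝓡 n) M) ∈ D) : ContDiffAt ℝ ∞ (fibreEnergy F p) y :=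
  Finsler.contDiffAt_fibreEnergy (hF.contMDiffAt hy)

theorem IsFinslerMetricOn.fderiv_fderiv_fibreEnergy_self (hF : IsFinslerMetricOn F D) {p : M}
    {y : Vec n} (hy : (⟨p, y⟩ : TangentBundle (𝓡 n) M) ∈ D) (X : Vec n) :
    fderiv ℝ (fderiv ℝ (fibreEnergy F p)) y X y = fderiv ℝ (fibreEnergy F p) y X :=
  fderiv_fderiv_euler (hF.contDiffAt_fibreEnergy hy)
    ((eventually_fibre_mem hF.isOpen hy).mono fun _ h => hF.euler_fibreEnergy h) X

/-- Maximal rank of the Hilbert form is non-degeneracy of the metric tensor, wherever the metric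
function is smooth. -/
theorem injective_hilbertForm_iff_metricNondegenerateAt {u : TangentBundle (𝓡 n) M}
    (hF : ContMDiffAt (𝓡 n).tangent 𝓘(ℝ, ℝ) ∞ F u) :
    Function.Injective (hilbertForm (energyIn F u) (coords u u)) ↔ MetricNondegenerateAt F u := by
  have hs : (extChartAt (𝓡 n).tangent u).symm (coords u u) = u := extChartAt_to_inv u
  rw [injective_hilbertForm_iff (z := coords u u)
    (contDiffAt_energyIn (mem_extChartAt_target u) (by rwa [hs]))]
  have h : ∀ X Y : Vec n, metric F u X Y = localMetric (energyIn F u) (coords u u) X Y := by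
    intro X Y
    have h2 : metric F u X Y = localMetric (energyIn F u) (coords u u)
      (coords u (⟨u.proj, X⟩ : TangentBundle (𝓡 n) M)).2
      (coords u (⟨u.proj, Y⟩ : TangentBundle (𝓡 n) M)).2 := rfl
    rw [h2, coords_self_fibre, coords_self_fibre]
  constructor
  · exact fun H X hX => H X fun Y => (h Y X).symm.trans (hX Y)
  · exact fun H X hX => H X fun Y => (h Y X).trans (hX Y)

theorem metricNondegenerateAt_iff {p : M} {y : Vec n}
    (hF : ContMDiffAt (𝓡 n).tangent 𝓘(ℝ, ℝ) ∞ F (⟨p, y⟩ : TangentBundle (𝓡 n) M)) :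
    MetricNondegenerateAt F (⟨p, y⟩ : TangentBundle (𝓡 n) M) ↔
      ∀ X : Vec n, (∀ Y : Vec n, fderiv ℝ (fderiv ℝ (fibreEnergy F p)) y Y X = 0) → X = 0 := by
  constructor
  · exact fun H X hX => H X fun Y => (metric_eq hF Y X).trans (hX Y)
  · exact fun H X hX => H X fun Y => (metric_eq hF Y X).symm.trans (hX Y)

theorem IsFinslerMetricOn.fibre_nondegenerate (hF : IsFinslerMetricOn F D) {p : M} {y : Vec n}
    (hy : (⟨p, y⟩ : TangentBundle (𝓡 n) M) ∈ D) (X : Vec n)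
    (hX : ∀ Y : Vec n, fderiv ℝ (fderiv ℝ (fibreEnergy F p)) y Y X = 0) : X = 0 :=
  (metricNondegenerateAt_iff (hF.contMDiffAt hy)).1
    ((injective_hilbertForm_iff_metricNondegenerateAt (hF.contMDiffAt hy)).1
      (hF.maximalRank _ hy)) X hX

/-- A zero of `F` would be a critical point of the energy, and then Euler's identity would put the
direction itself in the kernel of the metric tensor. -/
theorem IsFinslerMetricOn.pos (hF : IsFinslerMetricOn F D) {u : TangentBundle (𝓡 n) M}
    (hu : u ∈ D) : 0 < F u := by
  obtain ⟨p, y⟩ := u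
  refine (hF.nonneg _ hu).lt_of_ne fun h0 => hF.slit _ hu ?_
  refine hF.fibre_nondegenerate hu _ fun Y => ?_
  rw [hF.fderiv_fderiv_fibreEnergy_self hu]
  have h := (((contDiffAt_fibre (hF.contMDiffAt hu)).differentiableAt
    (by simp)).hasFDerivAt.pow 2).const_mul (1 / 2)
  have h' : HasFDerivAt (fibreEnergy F p) _ y := h
  rw [h'.fderiv]
  simp [← h0]

section Concurrent

variable {p : M} {y : Vec n}

theorem IsFinslerMetricOn.eventually_contDiffAt_energyIn (hF : IsFinslerMetricOn F D)
    {u : TangentBundle (𝓡 n) M} (hu : u ∈ D) :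
    ∀ᶠ z in 𝓝 (coords u u), ContDiffAt ℝ ∞ (energyIn F u) z :=
  (eventually_symm_mem hF.isOpen hu).mono fun _ h =>
    contDiffAt_energyIn h.1 (hF.contMDiffAt h.2)

theorem IsFinslerMetricOn.eventually_euler_energyIn (hF : IsFinslerMetricOn F D)
    {u : TangentBundle (𝓡 n) M} (hu : u ∈ D) :
    ∀ᶠ z in 𝓝 (coords u u), fderiv ℝ (energyIn F u) z (0, z.2) = 2 * energyIn F u z :=
  (eventually_symm_mem hF.isOpen hu).mono fun _ h => hF.euler_energyIn h.1 h.2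

theorem IsConcurrentOn.contMDiffAt (hφ : IsConcurrentOn F φ D) (hD : IsOpen D)
    {u : TangentBundle (𝓡 n) M} (hu : u ∈ D) :
    ContMDiffAt (𝓡 n).tangent (𝓡 n).tangent ∞
      (fun u => (⟨u.proj, φ u⟩ : TangentBundle (𝓡 n) M)) u :=
  hφ.smooth.contMDiffAt (hD.mem_nhds hu)

theorem IsConcurrentOn.contDiffAt_fieldIn (hφ : IsConcurrentOn F φ D) (hD : IsOpen D)
    {u : TangentBundle (𝓡 n) M} (hu : u ∈ D) : ContDiffAt ℝ ∞ (fieldIn φ u) (coords u u) := by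
  have hs : (extChartAt (𝓡 n).tangent u).symm (coords u u) = u := extChartAt_to_inv u
  exact Finsler.contDiffAt_fieldIn (mem_extChartAt_target u) (by
    rw [hs]; exact hφ.contMDiffAt hD hu)

/-- A concurrent field does not depend on the directional argument. -/
theorem IsConcurrentOn.hasFDerivAt_fibreField (hφ : IsConcurrentOn F φ D)
    (hF : IsFinslerMetricOn F D) (hy : (⟨p, y⟩ : TangentBundle (𝓡 n) M) ∈ D) :
    HasFDerivAt (fibreField φ p) (0 : Vec n →L[ℝ] Vec n) y := by
  have hY := (hφ.contDiffAt_fieldIn hF.isOpen hy).differentiableAt (by simp)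
  have hv := hφ.ver _ hy
  simp only [berwaldVer_eq (hF.eventually_contDiffAt_energyIn hy) (hF.maximalRank _ hy)
    (hF.eventually_euler_energyIn hy) hY] at hv
  have hc : coords (⟨p, y⟩ : TangentBundle (𝓡 n) M) ⟨p, y⟩ = _ := coords_self_fibre ⟨p, y⟩ y
  rw [hc] at hY hv
  have h := hY.hasFDerivAt.comp y (hasFDerivAt_mk_right _ y)
  have h1 : fieldIn φ (⟨p, y⟩ : TangentBundle (𝓡 n) M) ∘ (fun y' => (extChartAt (𝓡 n) p p, y'))
      = fibreField φ p := funext (fieldIn_self_fibre φ ⟨p, y⟩)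
  have h2 : HasFDerivAt (fibreField φ p) _ y := h1 ▸ h
  refine h2.congr_fderiv ?_
  ext1 X
  exact hv X

/-- The `π`-form associated with a concurrent field does not depend on the directional argument. -/
theorem IsConcurrentOn.fderiv_form (hφ : IsConcurrentOn F φ D)
    (hF : IsFinslerMetricOn F D) (hy : (⟨p, y⟩ : TangentBundle (𝓡 n) M) ∈ D) (Z : Vec n) :
    fderiv ℝ (fun y' => fderiv ℝ (fderiv ℝ (fibreEnergy F p)) y' (fibreField φ p y') Z) y = 0 := by
  have hY := hφ.contDiffAt_fieldIn hF.isOpen hy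
  have hL := hF.eventually_contDiffAt_energyIn hy
  have hv := fun X => hφ.ver_form _ hy X Z
  simp only [berwaldVerForm_eq hL (hF.maximalRank _ hy) (hF.eventually_euler_energyIn hy)] at hv
  have hd := (contDiffAt_localMetric hL.self_of_nhds hY
    (contDiffAt_const (c := Z))).differentiableAt (by simp)
  have hc : coords (⟨p, y⟩ : TangentBundle (𝓡 n) M) ⟨p, y⟩ = _ := coords_self_fibre ⟨p, y⟩ y
  rw [hc] at hd hv
  have h := hd.hasFDerivAt.comp y (hasFDerivAt_mk_right _ y)
  have h1 : (fun y' => fderiv ℝ (fderiv ℝ (fibreEnergy F p)) y' (fibreField φ p y') Z) =ᶠ[𝓝 y]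
      (fun z => localMetric (energyIn F ⟨p, y⟩) z (fieldIn φ ⟨p, y⟩ z) Z) ∘
        (fun y' => (extChartAt (𝓡 n) p p, y')) := by
    filter_upwards [eventually_fibre_mem hF.isOpen hy] with y' hy'
    have h3 : (fun y' => energyIn F ⟨p, y⟩ (extChartAt (𝓡 n) p p, y')) = fibreEnergy F p :=
      funext (energyIn_self_fibre F ⟨p, y⟩)
    have h4 : fieldIn φ ⟨p, y⟩ (extChartAt (𝓡 n) p p, y') = fibreField φ p y' :=
      fieldIn_self_fibre φ ⟨p, y⟩ y'
    have h5 := contDiffAt_energyIn (u := ⟨p, y⟩) (mem_target_self_fibre ⟨p, y⟩ y')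
      (by rw [extChartAt_tangent_symm_self]; exact hF.contMDiffAt hy')
    rw [Function.comp_apply, h4, ← h3]
    exact (localMetric_eq_fibre h5 _ _).symm
  rw [(h.congr_of_eventuallyEq h1).fderiv]
  ext1 X
  exact hv X

theorem Phi_fibre (hF : ContMDiffAt (𝓡 n).tangent 𝓘(ℝ, ℝ) ∞ F (⟨p, y⟩ : TangentBundle (𝓡 n) M)) :
    Phi F φ (⟨p, y⟩ : TangentBundle (𝓡 n) M)
      = fderiv ℝ (fderiv ℝ (fibreEnergy F p)) y (fibreField φ p y) y :=
  metric_eq hF _ _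

theorem gNorm_fibre (hF : ContMDiffAt (𝓡 n).tangent 𝓘(ℝ, ℝ) ∞ F (⟨p, y⟩ : TangentBundle (𝓡 n) M)) :
    gNorm F φ (⟨p, y⟩ : TangentBundle (𝓡 n) M)
      = fderiv ℝ (fderiv ℝ (fibreEnergy F p)) y (fibreField φ p y) (fibreField φ p y) :=
  metric_eq hF _ _

/-- The derivative of `Φ` along the fibre is the associated `π`-form: by Euler's identity
`Φ = dE (φ)` on the fibre, where `φ` is constant to first order. -/
theorem IsConcurrentOn.hasFDerivAt_Phi (hφ : IsConcurrentOn F φ D)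
    (hF : IsFinslerMetricOn F D) (hy : (⟨p, y⟩ : TangentBundle (𝓡 n) M) ∈ D) :
    HasFDerivAt (fun y' : Vec n => Phi F φ (⟨p, y'⟩ : TangentBundle (𝓡 n) M))
      (fderiv ℝ (fderiv ℝ (fibreEnergy F p)) y (fibreField φ p y)) y := by
  have h1 : (fun y' : Vec n => Phi F φ (⟨p, y'⟩ : TangentBundle (𝓡 n) M)) =ᶠ[𝓝 y]
      fun y' => fderiv ℝ (fibreEnergy F p) y' (fibreField φ p y') := by
    filter_upwards [eventually_fibre_mem hF.isOpen hy] with y' hy'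
    rw [Phi_fibre (hF.contMDiffAt hy'), hF.fderiv_fderiv_fibreEnergy_self hy']
  have hd : ContDiffAt ℝ ∞ (fderiv ℝ (fibreEnergy F p)) y :=
    (hF.contDiffAt_fibreEnergy hy).fderiv_right (by simp)
  refine (((hd.differentiableAt (by simp)).hasFDerivAt.clm_apply
    (hφ.hasFDerivAt_fibreField hF hy)).congr_of_eventuallyEq h1).congr_fderiv ?_
  ext1 X
  simp [fderiv_fderiv_symm (hF.contDiffAt_fibreEnergy hy) X]

theorem IsConcurrentOn.contMDiffAt_Phi (hφ : IsConcurrentOn F φ D)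
    (hF : IsFinslerMetricOn F D) {u : TangentBundle (𝓡 n) M} (hu : u ∈ D) :
    ContMDiffAt (𝓡 n).tangent 𝓘(ℝ, ℝ) ∞ (Phi F φ) u :=
  Finsler.contMDiffAt_Phi
    ((hF.isOpen.eventually_mem hu).mono fun _ h => hF.contMDiffAt h) (hφ.contMDiffAt hF.isOpen hu)

/-- `Φ` is affine to second order along the fibre. -/
theorem IsConcurrentOn.fderiv_fderiv_Phi (hφ : IsConcurrentOn F φ D)
    (hF : IsFinslerMetricOn F D) (hy : (⟨p, y⟩ : TangentBundle (𝓡 n) M) ∈ D) :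
    fderiv ℝ (fderiv ℝ fun y' : Vec n => Phi F φ (⟨p, y'⟩ : TangentBundle (𝓡 n) M)) y = 0 := by
  have hP := contDiffAt_fibre (hφ.contMDiffAt_Phi hF hy)
  have hd := ((hP.fderiv_right (m := ∞) (by simp)).differentiableAt (by simp)).hasFDerivAt
  ext X Z
  have h1 := (hd.clm_apply (hasFDerivAt_const Z y)).fderiv
  have h2 : (fun y' => fderiv ℝ (fun y' : Vec n => Phi F φ (⟨p, y'⟩ : TangentBundle (𝓡 n) M)) y' Z)
      =ᶠ[𝓝 y] fun y' => fderiv ℝ (fderiv ℝ (fibreEnergy F p)) y' (fibreField φ p y') Z := by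
    filter_upwards [eventually_fibre_mem hF.isOpen hy] with y' hy'
    rw [(hφ.hasFDerivAt_Phi hF hy').fderiv]
  rw [h2.fderiv_eq, hφ.fderiv_form hF hy] at h1
  simpa using (congrArg (fun f => f X) h1).symm

end Concurrent

end FinslerFibre

/-! ### The generalized Kropina change -/

section Kropina

variable {n : ℕ} {M : Type*} [TopologicalSpace M] [ChartedSpace (Vec n) M] [IsManifold (𝓡 n) ∞ M]
  {F : TangentBundle (𝓡 n) M → ℝ} {D : Set (TangentBundle (𝓡 n) M)}
  {φ : (u : TangentBundle (𝓡 n) M) → TangentSpace (𝓡 n) u.proj} {m : ℝ}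

theorem Phi_ne_zero_of_mem_kropinaDomain {u : TangentBundle (𝓡 n) M}
    (hu : u ∈ kropinaDomain m F φ D) : Phi F φ u ≠ 0 :=
  hu.2.elim ne_of_gt And.left

theorem kropina_ne_zero (hF : IsFinslerMetricOn F D) {u : TangentBundle (𝓡 n) M}
    (hu : u ∈ kropinaDomain m F φ D) : kropina m F φ u ≠ 0 := by
  refine mul_ne_zero (Real.rpow_pos_of_pos (hF.pos hu.1) _).ne' ?_
  obtain h | ⟨h, k, rfl⟩ := hu.2
  · exact (Real.rpow_pos_of_pos h _).ne'
  · -- for a negative base the power has to be read as an integer power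
    rw [← Int.cast_neg, Real.rpow_intCast]
    exact zpow_ne_zero _ h

theorem contMDiffAt_kropina (hF : IsFinslerMetricOn F D) (hφ : IsConcurrentOn F φ D)
    {u : TangentBundle (𝓡 n) M} (hu : u ∈ kropinaDomain m F φ D) :
    ContMDiffAt (𝓡 n).tangent 𝓘(ℝ, ℝ) ∞ (kropina m F φ) u := by
  have h1 : ContMDiffAt (𝓡 n).tangent 𝓘(ℝ, ℝ) ∞ (fun w => F w ^ (m + 1)) u :=
    (Real.contDiffAt_rpow_const_of_ne (hF.pos hu.1).ne').contMDiffAt.comp u (hF.contMDiffAt hu.1)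
  have h2 : ContMDiffAt (𝓡 n).tangent 𝓘(ℝ, ℝ) ∞ (fun w => Phi F φ w ^ (-m)) u :=
    (Real.contDiffAt_rpow_const_of_ne (Phi_ne_zero_of_mem_kropinaDomain hu)).contMDiffAt.comp u
      (hφ.contMDiffAt_Phi hF hu.1)
  exact h1.mul h2

theorem metricNondegenerateAt_kropina_iff (hF : IsFinslerMetricOn F D)
    (hφ : IsConcurrentOn F φ D) (hm1 : m ≠ -1) {p : M} {y : Vec n}
    (hu : (⟨p, y⟩ : TangentBundle (𝓡 n) M) ∈ kropinaDomain m F φ D) :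
    MetricNondegenerateAt (kropina m F φ) (⟨p, y⟩ : TangentBundle (𝓡 n) M) ↔
      m * F (⟨p, y⟩ : TangentBundle (𝓡 n) M) ^ 2 * gNorm F φ (⟨p, y⟩ : TangentBundle (𝓡 n) M)
        - (m - 1) * Phi F φ (⟨p, y⟩ : TangentBundle (𝓡 n) M) ^ 2 ≠ 0 := by
  have hy := hu.1
  have hFy := hF.contMDiffAt hy
  have hs := fderiv_fderiv_symm (hF.contDiffAt_fibreEnergy hy)
  have he := hF.fderiv_fderiv_fibreEnergy_self hy
  have hP := (hφ.hasFDerivAt_Phi hF hy).fderiv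
  have hSe : fibreEnergy F p y = (1 / 2) * fderiv ℝ (fderiv ℝ (fibreEnergy F p)) y y y := by
    rw [he, hF.euler_fibreEnergy hy]
    ring
  have hS : F ⟨p, y⟩ ^ 2 = fderiv ℝ (fderiv ℝ (fibreEnergy F p)) y y y := by
    rw [fibreEnergy] at hSe
    linarith
  have hΦ := Phi_fibre (φ := φ) hFy
  have hΦ0 := Phi_ne_zero_of_mem_kropinaDomain hu
  have hF0 := (hF.pos hy).ne'
  have hhess := fderiv_fderiv_kropinaEnergy (m := m) (y := y)
    (f := fun y' : Vec n => F (⟨p, y'⟩ : TangentBundle (𝓡 n) M))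
    (P := fun y' : Vec n => Phi F φ (⟨p, y'⟩ : TangentBundle (𝓡 n) M))
    (e := fibreEnergy F p) (W := fibreEnergy (kropina m F φ) p) (fun _ => rfl) (fun _ => rfl)
    (contDiffAt_fibre hFy) (contDiffAt_fibre (hφ.contMDiffAt_Phi hF hy)) hF0 hΦ0
    (hφ.fderiv_fderiv_Phi hF hy)
  have hW : fibreEnergy (kropina m F φ) p y ≠ 0 :=
    mul_ne_zero (by norm_num) (pow_ne_zero 2 (kropina_ne_zero hF hu))
  rw [metricNondegenerateAt_iff (contMDiffAt_kropina hF hφ hu), gNorm_fibre hFy, hS, hΦ,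
    ← kropinaForm_nondegenerate_iff (fderiv ℝ (fderiv ℝ (fibreEnergy F p)) y) hs
      (hF.fibre_nondegenerate hy) hm1 hW (hS ▸ pow_ne_zero 2 hF0) (hΦ ▸ hΦ0)]
  simp only [hhess, hP, hSe, hΦ, ← he, hs (fibreField φ p y)]

/-! ### Homogeneity and the domain of the Kropina change -/

omit [IsManifold (𝓡 n) ∞ M] in
/-- A function that is infinitesimally homogeneous of degree one on a conic set is positively
homogeneous there: `f (t u) / t` is constant in `t`. -/
theorem map_smul_of_hasDerivAt {f : TangentBundle (𝓡 n) M → ℝ}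
    (hD : ∀ u ∈ D, ∀ t : ℝ, 0 < t → (⟨u.proj, t • u.snd⟩ : TangentBundle (𝓡 n) M) ∈ D)
    (hf : ∀ u ∈ D,
      HasDerivAt (fun t : ℝ => f (⟨u.proj, t • u.snd⟩ : TangentBundle (𝓡 n) M)) (f u) 1)
    {u : TangentBundle (𝓡 n) M} (hu : u ∈ D) {t : ℝ} (ht : 0 < t) :
    f (⟨u.proj, t • u.snd⟩ : TangentBundle (𝓡 n) M) = t * f u := by
  set h : ℝ → ℝ := fun t => f (⟨u.proj, t • u.snd⟩ : TangentBundle (𝓡 n) M) with hh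
  have hd : ∀ s : ℝ, 0 < s → HasDerivAt h (h s / s) s := by
    intro s hs
    have h1 := hf _ (hD u hu s hs)
    have h2 : HasDerivAt (fun r : ℝ => r / s) (1 / s) s := (hasDerivAt_id s).div_const s
    have h3 := HasDerivAt.comp (h := fun r : ℝ => r / s) s
      (h₂ := fun t : ℝ => f (⟨u.proj, t • s • u.snd⟩ : TangentBundle (𝓡 n) M))
      (h₂' := h s) (by rw [div_self hs.ne']; exact h1) h2
    have h4 : ((fun t : ℝ => f (⟨u.proj, t • s • u.snd⟩ : TangentBundle (𝓡 n) M)) ∘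
        fun r : ℝ => r / s) = h := by
      funext r
      simp only [Function.comp_apply, hh, smul_smul, div_mul_cancel₀ r hs.ne']
    rw [h4] at h3
    exact h3.congr_deriv (by ring)
  have hq : ∀ s ∈ Ioi (0 : ℝ), HasDerivAt (fun s => h s / s) 0 s := by
    intro s hs
    have hs0 : s ≠ 0 := ne_of_gt hs
    refine ((hd s hs).div (hasDerivAt_id s) hs0).congr_deriv ?_
    simp
    field_simp
    simp
  have hc := isOpen_Ioi.is_const_of_deriv_eq_zero isPreconnected_Ioi
    (fun s hs => (hq s hs).differentiableAt.differentiableWithinAt)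
    (fun s hs => (hq s hs).deriv) (mem_Ioi.2 ht) (mem_Ioi.2 one_pos)
  have h1 : h 1 = f u := by rw [hh]; simp only [one_smul]
  rw [h1, div_one, div_eq_iff ht.ne'] at hc
  rw [← hh] at *
  linarith

theorem IsConcurrentOn.hasDerivAt_Phi_ray (hφ : IsConcurrentOn F φ D)
    (hF : IsFinslerMetricOn F D) {u : TangentBundle (𝓡 n) M} (hu : u ∈ D) :
    HasDerivAt (fun t : ℝ => Phi F φ (⟨u.proj, t • u.snd⟩ : TangentBundle (𝓡 n) M))
      (Phi F φ u) 1 := by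
  let y : Vec n := u.snd
  have h1 : HasDerivAt (fun t : ℝ => t • y) ((1 : ℝ) • y) 1 :=
    (hasDerivAt_id (1 : ℝ)).smul_const y
  have h2 := HasFDerivAt.comp_hasDerivAt (f := fun t : ℝ => t • y) 1
    (by rw [one_smul]; exact hφ.hasFDerivAt_Phi (p := u.proj) (y := y) hF hu) h1
  rw [one_smul, ← Phi_fibre (hF.contMDiffAt hu)] at h2
  exact h2

theorem hasDerivAt_kropina_ray (hF : IsFinslerMetricOn F D) (hφ : IsConcurrentOn F φ D)
    {u : TangentBundle (𝓡 n) M} (hu : u ∈ kropinaDomain m F φ D) :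
    HasDerivAt (fun t : ℝ => kropina m F φ (⟨u.proj, t • u.snd⟩ : TangentBundle (𝓡 n) M))
      (kropina m F φ u) 1 := by
  have hF0 := (hF.pos hu.1).ne'
  have hΦ0 := Phi_ne_zero_of_mem_kropinaDomain hu
  have h1 : (⟨u.proj, (1 : ℝ) • u.snd⟩ : TangentBundle (𝓡 n) M) = u := by rw [one_smul]
  have h2 := (hF.homogeneous u hu.1).rpow_const (p := m + 1) (Or.inl (by rwa [h1]))
  have h3 := (hφ.hasDerivAt_Phi_ray hF hu.1).rpow_const (p := -m) (Or.inl (by rwa [h1]))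
  refine (h2.mul h3).congr_deriv ?_
  rw [h1, Real.rpow_sub_one hF0, Real.rpow_sub_one hΦ0, kropina]
  field_simp
  ring

theorem isOpen_kropinaDomain (hF : IsFinslerMetricOn F D) (hφ : IsConcurrentOn F φ D) :
    IsOpen (kropinaDomain m F φ D) := by
  rw [isOpen_iff_eventually]
  rintro u ⟨hu, h⟩
  have hc := (hφ.contMDiffAt_Phi hF hu).continuousAt
  obtain h | ⟨h, hk⟩ := h
  · filter_upwards [hF.isOpen.eventually_mem hu, hc.tendsto.eventually_const_lt h] with w h1 h2
    exact ⟨h1, Or.inl h2⟩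
  · filter_upwards [hF.isOpen.eventually_mem hu, hc.eventually_ne h] with w h1 h2
    exact ⟨h1, Or.inr ⟨h2, hk⟩⟩

theorem kropinaDomain_conic (hF : IsFinslerMetricOn F D) (hφ : IsConcurrentOn F φ D)
    {u : TangentBundle (𝓡 n) M} (hu : u ∈ kropinaDomain m F φ D) {t : ℝ} (ht : 0 < t) :
    (⟨u.proj, t • u.snd⟩ : TangentBundle (𝓡 n) M) ∈ kropinaDomain m F φ D := by
  have h := map_smul_of_hasDerivAt hF.conic (fun _ => hφ.hasDerivAt_Phi_ray hF) hu.1 ht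
  refine ⟨hF.conic u hu.1 t ht, hu.2.imp (fun h1 => ?_) (fun h1 => ⟨?_, h1.2⟩)⟩
  · rw [h]
    exact mul_pos ht h1
  · rw [h]
    exact mul_ne_zero ht.ne' h1.1

/-- Apart from the rank of its Hilbert form, the changed metric is always a Finsler metric. -/
theorem isFinslerMetricOn_kropina (hF : IsFinslerMetricOn F D) (hφ : IsConcurrentOn F φ D)
    (h : ∀ u ∈ kropinaDomain m F φ D, 0 < kropina m F φ u →
      MetricNondegenerateAt (kropina m F φ) u) :
    IsFinslerMetricOn (kropina m F φ)
      {u | u ∈ kropinaDomain m F φ D ∧ 0 < kropina m F φ u} where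
  isOpen := by
    rw [isOpen_iff_eventually]
    rintro u ⟨hu, h0⟩
    exact ((isOpen_kropinaDomain hF hφ).eventually_mem hu).and
      ((contMDiffAt_kropina hF hφ hu).continuousAt.tendsto.eventually_const_lt h0)
  slit u hu := hF.slit u hu.1.1
  conic u hu t ht := by
    refine ⟨kropinaDomain_conic hF hφ hu.1 ht, ?_⟩
    rw [map_smul_of_hasDerivAt (fun _ h _ => kropinaDomain_conic hF hφ h)
      (fun _ => hasDerivAt_kropina_ray hF hφ) hu.1 ht]
    exact mul_pos ht hu.2
  nonneg u hu := hu.2.le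
  smooth u hu := (contMDiffAt_kropina hF hφ hu.1).contMDiffWithinAt
  homogeneous u hu := hasDerivAt_kropina_ray hF hφ hu.1
  maximalRank u hu := (injective_hilbertForm_iff_metricNondegenerateAt
    (contMDiffAt_kropina hF hφ hu.1)).2 (h u hu.1 hu.2)

end Kropina

end Finsler

end

theorem theorem1 {n : ℕ} {M : Type*} [TopologicalSpace M] [ChartedSpace (Finsler.Vec n) M]
    [IsManifold (𝓡 n) ∞ M]
    (D : Set (TangentBundle (𝓡 n) M)) (F : TangentBundle (𝓡 n) M → ℝ)
    (hF : Finsler.IsFinslerMetricOn F D)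
    (φ : (u : TangentBundle (𝓡 n) M) → TangentSpace (𝓡 n) u.proj)
    (hφ : Finsler.IsConcurrentOn F φ D)
    (m : ℝ) (hm0 : m ≠ 0) (hm1 : m ≠ -1) :
    (Finsler.IsFinslerMetricOn (Finsler.kropina m F φ)
        {u | u ∈ Finsler.kropinaDomain m F φ D ∧ 0 < Finsler.kropina m F φ u} ↔
      ∀ u ∈ Finsler.kropinaDomain m F φ D, 0 < Finsler.kropina m F φ u →
        m * F u ^ 2 * Finsler.gNorm F φ u - (m - 1) * Finsler.Phi F φ u ^ 2 ≠ 0) ∧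
    (∀ u ∈ Finsler.kropinaDomain m F φ D,
      (Finsler.MetricNondegenerateAt (Finsler.kropina m F φ) u ↔
        m * F u ^ 2 * Finsler.gNorm F φ u - (m - 1) * Finsler.Phi F φ u ^ 2 ≠ 0)) := by
  have key := fun u (hu : u ∈ Finsler.kropinaDomain m F φ D) =>
    Finsler.metricNondegenerateAt_kropina_iff hF hφ hm1 (p := u.proj) (y := u.snd) hu
  refine ⟨⟨fun h u hu h0 => ?_, fun h => ?_⟩, key⟩
  · exact (key u hu).1 ((Finsler.injective_hilbertForm_iff_metricNondegenerateAt
      (Finsler.contMDiffAt_kropina hF hφ hu)).1 (h.maximalRank u ⟨hu, h0⟩))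
  · exact Finsler.isFinslerMetricOn_kropina hF hφ fun u hu h0 => (key u hu).2 (h u hu h0)
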